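/- Let $1\le k\le p$ and $n$ be integers, and for $J\subseteq[p]$ and $v\in\mathbb{R}^p$ let $v|_J\in\mathbb{R}^J$ be the restriction of $v$ to the coordinates in $J$ and $\mathrm{supp}(v)$ the set of indices of its nonzero coordinates. Let $a$ be a random vector in $\mathbb{R}^p$ and $R\in\mathbb{R}$ such that, for every $J\subseteq[p]$ with $|J|=k$, (i) $\|a|_J\|_2^2\le R$ almost surely, and (ii) the matrix $C_J:=\mathbb{E}\big[a|_J\,a|_J^{\mathrm T}\big]$ (the $J\times J$ principal submatrix of $C=\mathbb{E}[aa^{\mathrm T}]$) is not the zero matrix. Let $\theta_{\max}^J:=\lambda_{\max}(C_J)$ denote the largest eigenvalue of $C_J$, and put $$\overline\theta:=\max_{|J|=k}\theta_{\max}^J,\qquad \widetilde\theta:=\min_{|J|=k}\theta_{\max}^J,\qquad h(\tau):=(1+\tau)\log(1+\tau)-\tau .$$ Let $a_1,\dots,a_n$ be independent copies of $a$ on a probability space, let $y_1,\dots,y_n\in\{0,1\}$ be random labels (with arbitrary joint law with the $a_i$), let $\eta>0$, and let $$f(x)=\frac1n\sum_{i=1}^n\Big(\log\big(1+e^{\langle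 a_i,x\rangle}\big)-y_i\langle a_i,x\rangle\Big)+\frac{\eta}{2}\|x\|_2^2,\qquad x\in\mathbb{R}^p,$$ be the $\ell_2$-regularized logistic loss. A twice continuously differentiable function $f:\mathbb{R}^p\to\mathbb{R}$ with Hessian $H_f$ is said to have a Stable Restricted Hessian of order $k$ with constant $\mu_k$ ($\mu_k$-SRH) if, for every $x\in\mathbb{R}^p$ with $|\mathrm{supp}(x)|\le k$, $$B_k(x)>0\quad\text{and}\quad 1\le \frac{A_k(x)}{B_k(x)}\le\mu_k ,$$ where $A_k(x)$ and $B_k(x)$ are the supremum and the infimum of $\Delta^{\mathrm T}H_f(x)\Delta$ over all $\Delta\in\mathbb{R}^p$ with $\|\Delta\|_2=1$ and $|\mathrm{supp}(x)\cup\mathrm{supp}(\Delta)|\le k$. Let $\tau>0$ and $\varepsilon\in(0,1)$. If $$n\;\ge\;\frac{R\left(\log k+k\left(1+\log\frac pk\right)-\log\varepsilon\right)}{\widetilde\theta\,h(\tau)},$$ then with probability at least $1-\varepsilon$ the function $f$ has $\mu_k$-SRH for some $$\mu_k\le 1+\frac{1+\tau}{4\eta}\,\overline\theta .$$ More precisely,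 there is a measurable event of probability at least $1-\varepsilon$ on which this holds. -/

import Mathlib

open MeasureTheory ProbabilityTheory

namespace SparseLogistic

/-- The support of a vector, i.e. the set of indices of its nonzero coordinates. -/
noncomputable def supp {p : ℕ} (x : EuclideanSpace ℝ (Fin p)) : Finset (Fin p) :=
  Finset.univ.filter fun j => x j ≠ 0

/-- The Hessian quadratic form `Δᵀ H_f(x) Δ`, through the second Fréchet derivative of `f`. -/
noncomputable def hessianForm {p : ℕ} (f : EuclideanSpace ℝ (Fin p) → ℝ)
    (x Δ : EuclideanSpace ℝ (Fin p)) : ℝ :=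
  fderiv ℝ (fderiv ℝ f) x Δ Δ

/-- The set of values `Δᵀ H_f(x) Δ` over all `Δ` with `|supp x ∪ supp Δ| ≤ k` and `‖Δ‖₂ = 1`. -/
def restrictedCurvatures {p : ℕ} (f : EuclideanSpace ℝ (Fin p) → ℝ) (k : ℕ)
    (x : EuclideanSpace ℝ (Fin p)) : Set ℝ :=
  {q | ∃ Δ : EuclideanSpace ℝ (Fin p),
    (supp x ∪ supp Δ).card ≤ k ∧ ‖Δ‖ = 1 ∧ q = hessianForm f x Δ}

/-- `A_k(x)`: the supremum of the restricted curvatures at `x`. -/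
noncomputable def upperCurvature {p : ℕ} (f : EuclideanSpace ℝ (Fin p) → ℝ) (k : ℕ)
    (x : EuclideanSpace ℝ (Fin p)) : ℝ :=
  sSup (restrictedCurvatures f k x)

/-- `B_k(x)`: the infimum of the restricted curvatures at `x`. -/
noncomputable def lowerCurvature {p : ℕ} (f : EuclideanSpace ℝ (Fin p) → ℝ) (k : ℕ)
    (x : EuclideanSpace ℝ (Fin p)) : ℝ :=
  sInf (restrictedCurvatures f k x)

/-- `f` has a Stable Restricted Hessian of order `k` with constant `m`: it is twice continuously
differentiable and `1 ≤ A_k(x) / B_k(x) ≤ m` at every `k`-sparse `x`. Positivity of `B_k(x)`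
(convexity over sparse subspaces), which the ratio presupposes, is made explicit. -/
def HasSRH {p : ℕ} (f : EuclideanSpace ℝ (Fin p) → ℝ) (k : ℕ) (m : ℝ) : Prop :=
  ContDiff ℝ 2 f ∧
    ∀ x : EuclideanSpace ℝ (Fin p), (supp x).card ≤ k →
      0 < lowerCurvature f k x ∧
      1 ≤ upperCurvature f k x / lowerCurvature f k x ∧
      upperCurvature f k x / lowerCurvature f k x ≤ m

/-- The logistic loss of the data `(a_i, y_i)`, `i = 1, …, n`. -/
noncomputable def logisticLoss {p n : ℕ} (a : Fin n → EuclideanSpace ℝ (Fin p)) (y : Fin n → ℝ)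
    (x : EuclideanSpace ℝ (Fin p)) : ℝ :=
  (1 / (n : ℝ)) *
    ∑ i, (Real.log (1 + Real.exp (inner ℝ (a i) x)) - y i * inner ℝ (a i) x)

/-- The `ℓ₂`-regularized logistic loss with penalty coefficient `η`. -/
noncomputable def regLogisticLoss {p n : ℕ} (η : ℝ) (a : Fin n → EuclideanSpace ℝ (Fin p))
    (y : Fin n → ℝ) (x : EuclideanSpace ℝ (Fin p)) : ℝ :=
  logisticLoss a y x + η / 2 * ‖x‖ ^ 2

/-- The second moment matrix `C = 𝔼[a aᵀ]` of a random vector `a` with law `ν`. -/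
noncomputable def secondMoment {p : ℕ} (ν : Measure (EuclideanSpace ℝ (Fin p))) :
    Matrix (Fin p) (Fin p) ℝ :=
  Matrix.of fun i j => ∫ v, v i * v j ∂ν

/-- The principal submatrix `P_Jᵀ C P_J` of `C` with rows and columns in `J`. -/
def restrict {p : ℕ} (C : Matrix (Fin p) (Fin p) ℝ) (J : Finset (Fin p)) : Matrix J J ℝ :=
  C.submatrix (fun j => (j : Fin p)) (fun j => (j : Fin p))

/-- The largest (real) eigenvalue of a square matrix; used for symmetric matrices only. -/
noncomputable def lambdaMax {ι : Type*} [Fintype ι] [DecidableEq ι] (M : Matrix ι ι ℝ) : ℝ :=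
  sSup (spectrum ℝ M)

/-- `θ_max^J = λ_max(P_Jᵀ C P_J)`. -/
noncomputable def thetaMax {p : ℕ} (ν : Measure (EuclideanSpace ℝ (Fin p)))
    (J : Finset (Fin p)) : ℝ :=
  lambdaMax (restrict (secondMoment ν) J)

/-- The maximum of `θ_max^J` over the index sets `J` with exactly `k` elements. -/
noncomputable def thetaBar {p : ℕ} (ν : Measure (EuclideanSpace ℝ (Fin p))) (k : ℕ) : ℝ :=
  ⨆ J : {J : Finset (Fin p) // J.card = k}, thetaMax ν J.1

/-- The minimum of `θ_max^J` over the index sets `J` with exactly `k` elements. -/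
noncomputable def thetaTilde {p : ℕ} (ν : Measure (EuclideanSpace ℝ (Fin p))) (k : ℕ) : ℝ :=
  ⨅ J : {J : Finset (Fin p) // J.card = k}, thetaMax ν J.1

/-- `h(τ) = (1 + τ) log (1 + τ) - τ`. -/
noncomputable def h (τ : ℝ) : ℝ := (1 + τ) * Real.log (1 + τ) - τ

end SparseLogistic

/-! The Hessian of the loss is `(1/n) ∑ σ'(⟨aᵢ, x⟩) aᵢ aᵢᵀ + η I` with `0 ≤ σ' ≤ 1/4`. If for every
`J` of size `k` the Gram sum of the restricted `aᵢ` has top eigenvalue at most `n B`, all restricted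
curvatures lie in `[η, η + B/4]` and the ratio is at most `1 + B/(4η)` (`hasSRH_of_forall_gram_le`).
What remains is an upper tail bound with `B = (1 + τ) θ̄`: a matrix Chernoff bound for each `J`,
then a union bound over `p.choose k ≤ (e p / k) ^ k` sets.

The Chernoff bound (`measureReal_lt_dotProduct_gram_le`) needs Golden–Thompson only for a rank one
perturbation, `tr exp(A + vvᵀ) ≤ tr (exp A exp(vvᵀ))`. This case is elementary and holds degree by
degree (`trace_add_vecMulVec_pow_le`): expand the power and merge products of moments `vᵀAⁱv` by
Chebyshev's inequality. Averaging over an independent `v` with `|v|² ≤ R`, each new summand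
multiplies the mean trace exponential by at most `1 + θ (exp(tR) - 1) / R`. All series stay
truncated, so only moments of bounded entries are integrated; the truncation is removed after
Markov's inequality. -/

namespace SparseLogistic

open Matrix Finset

set_option linter.unusedSectionVars false

/-! ### Trace inequalities for rank one perturbations of positive semidefinite matrices. -/

section LinearAlgebra

variable {ι : Type*} [Fintype ι] [DecidableEq ι]

/-- Quadratic forms of the powers of a symmetric matrix, in an eigenbasis. -/
lemma exists_dotProduct_pow_mulVec_eq {A : Matrix ι ι ℝ} (hA : A.IsHermitian) (v : ι → ℝ) :
    ∃ c : ι → ℝ, ∀ i : ℕ, v ⬝ᵥ (A ^ i *ᵥ v) = ∑ l, c l ^ 2 * hA.eigenvalues l ^ i := by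
  set U : Matrix ι ι ℝ := (hA.eigenvectorUnitary : Matrix ι ι ℝ)
  refine ⟨Uᵀ *ᵥ v, fun i => ?_⟩
  have h : A ^ i = U * diagonal (fun l => hA.eigenvalues l ^ i) * Uᵀ := by
    conv_lhs => rw [hA.spectral_theorem]
    rw [← map_pow, Unitary.conjStarAlgAut_apply, diagonal_pow]
    rfl
  rw [h, ← mulVec_mulVec, ← mulVec_mulVec, dotProduct_mulVec, ← mulVec_transpose]
  simp only [dotProduct, mulVec_diagonal]
  exact Finset.sum_congr rfl fun l _ => by ring

lemma dotProduct_pow_mulVec_nonneg {A : Matrix ι ι ℝ} (hA : A.PosSemidef) (v : ι → ℝ) (i : ℕ) :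
    0 ≤ v ⬝ᵥ (A ^ i *ᵥ v) := by
  simpa using (hA.pow i).dotProduct_mulVec_nonneg v

/-- A Chebyshev inequality for the moments of a positive semidefinite matrix. -/
lemma dotProduct_pow_mul_dotProduct_pow_le {A : Matrix ι ι ℝ} (hA : A.PosSemidef) (v : ι → ℝ)
    (i j : ℕ) :
    (v ⬝ᵥ (A ^ i *ᵥ v)) * (v ⬝ᵥ (A ^ j *ᵥ v)) ≤ (v ⬝ᵥ v) * (v ⬝ᵥ (A ^ (i + j) *ᵥ v)) := by
  obtain ⟨c, hc⟩ := exists_dotProduct_pow_mulVec_eq hA.1 v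
  have h0 : v ⬝ᵥ v = ∑ l, c l ^ 2 := by simpa using hc 0
  rw [h0, hc, hc, hc]
  set e := hA.1.eigenvalues with he
  have hnn : ∀ l, 0 ≤ e l := hA.eigenvalues_nonneg
  -- Chebyshev's symmetrization: both powers are monotone on nonnegative eigenvalues, so the two
  -- differences have the same sign.
  have key : 0 ≤ ∑ l, ∑ m, c l ^ 2 * c m ^ 2 * ((e l ^ i - e m ^ i) * (e l ^ j - e m ^ j)) := by
    refine sum_nonneg fun l _ => sum_nonneg fun m _ => mul_nonneg (by positivity) ?_
    rcases le_total (e l) (e m) with h | h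
    · exact mul_nonneg_of_nonpos_of_nonpos (sub_nonpos.2 (pow_le_pow_left₀ (hnn l) h i))
        (sub_nonpos.2 (pow_le_pow_left₀ (hnn l) h j))
    · exact mul_nonneg (sub_nonneg.2 (pow_le_pow_left₀ (hnn m) h i))
        (sub_nonneg.2 (pow_le_pow_left₀ (hnn m) h j))
  have expand : ∑ l, ∑ m, c l ^ 2 * c m ^ 2 * ((e l ^ i - e m ^ i) * (e l ^ j - e m ^ j)) =
      2 * ((∑ l, c l ^ 2) * ∑ l, c l ^ 2 * e l ^ (i + j)) -
      2 * ((∑ l, c l ^ 2 * e l ^ i) * ∑ l, c l ^ 2 * e l ^ j) := by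
    have h1 : ∀ f g : ι → ℝ, (∑ l, f l) * ∑ l, g l = ∑ l, ∑ m, f l * g m :=
      fun f g => sum_mul_sum _ _ _ _
    have e1 := h1 (fun l => c l ^ 2) (fun l => c l ^ 2 * e l ^ (i + j))
    have e2 := h1 (fun l => c l ^ 2 * e l ^ (i + j)) (fun l => c l ^ 2)
    have e3 := h1 (fun l => c l ^ 2 * e l ^ i) (fun l => c l ^ 2 * e l ^ j)
    have e4 := h1 (fun l => c l ^ 2 * e l ^ j) (fun l => c l ^ 2 * e l ^ i)
    have : ∑ l, ∑ m, c l ^ 2 * c m ^ 2 * ((e l ^ i - e m ^ i) * (e l ^ j - e m ^ j)) =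
        (∑ l, ∑ m, c l ^ 2 * (c m ^ 2 * e m ^ (i + j))) +
        (∑ l, ∑ m, c l ^ 2 * e l ^ (i + j) * c m ^ 2) -
        (∑ l, ∑ m, c l ^ 2 * e l ^ i * (c m ^ 2 * e m ^ j)) -
        (∑ l, ∑ m, c l ^ 2 * e l ^ j * (c m ^ 2 * e m ^ i)) := by
      simp only [← sum_add_distrib, ← sum_sub_distrib]
      exact sum_congr rfl fun l _ => sum_congr rfl fun m _ => by ring
    rw [this, ← e1, ← e2, ← e3, ← e4]
    ring
  linarith

/-- Sorts the words in `A` and `B` by their last `B`. The mirrored version below sorts by the first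
`B`. -/
lemma add_pow_eq_left (A B : Matrix ι ι ℝ) (r : ℕ) :
    (A + B) ^ r = A ^ r + ∑ l ∈ range r, (A + B) ^ l * B * A ^ (r - 1 - l) := by
  induction r with
  | zero => simp
  | succ r ih =>
    have h : ∑ l ∈ range r, (A + B) ^ l * B * A ^ (r + 1 - 1 - l) =
        (∑ l ∈ range r, (A + B) ^ l * B * A ^ (r - 1 - l)) * A := by
      rw [sum_mul]
      refine sum_congr rfl fun l hl => ?_
      rw [mem_range] at hl
      rw [mul_assoc _ _ A, ← pow_succ]
      congr 2
      omega
    have e : (A + B) ^ (r + 1) = (A + B) ^ r * A + (A + B) ^ r * B := by rw [pow_succ, mul_add]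
    rw [sum_range_succ, h, e]
    nth_rewrite 1 [ih]
    simp [add_mul, pow_succ, add_assoc]

lemma add_pow_eq_right (A B : Matrix ι ι ℝ) (r : ℕ) :
    (A + B) ^ r = A ^ r + ∑ l ∈ range r, A ^ (r - 1 - l) * B * (A + B) ^ l := by
  induction r with
  | zero => simp
  | succ r ih =>
    have h : ∑ l ∈ range r, A ^ (r + 1 - 1 - l) * B * (A + B) ^ l =
        A * (∑ l ∈ range r, A ^ (r - 1 - l) * B * (A + B) ^ l) := by
      rw [mul_sum]
      refine sum_congr rfl fun l hl => ?_
      rw [mem_range] at hl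
      rw [← mul_assoc, ← mul_assoc, ← pow_succ']
      congr 3
      omega
    have e : (A + B) ^ (r + 1) = A * (A + B) ^ r + B * (A + B) ^ r := by rw [pow_succ', add_mul]
    rw [sum_range_succ, h, e]
    nth_rewrite 1 [ih]
    simp [mul_add, pow_succ', add_assoc]

lemma sum_range_choose_eq (r j : ℕ) : ∑ l ∈ range r, (l.choose j : ℝ) = r.choose (j + 1) := by
  induction r with
  | zero => simp
  | succ r ih => rw [sum_range_succ, ih, Nat.choose_succ_succ]; push_cast; ring

/-- Hockey-stick summation: it turns the sum over the position of the singled-out `B` into the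
coefficient `choose (j + 1)`. -/
lemma sum_sum_choose_mul (r : ℕ) (f : ℕ → ℝ) :
    ∑ l ∈ range r, ∑ j ∈ range (l + 1), (l.choose j : ℝ) * f j =
      ∑ j ∈ range r, (r.choose (j + 1) : ℝ) * f j := by
  have : ∀ l ∈ range r, ∑ j ∈ range (l + 1), (l.choose j : ℝ) * f j =
      ∑ j ∈ range r, (l.choose j : ℝ) * f j := by
    intro l hl
    rw [mem_range] at hl
    refine sum_subset (by simpa using hl) fun j _ hj => ?_
    rw [Nat.choose_eq_zero_of_lt (by simpa using hj)]
    simp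
  rw [sum_congr rfl this, sum_comm]
  refine sum_congr rfl fun j _ => ?_
  rw [← sum_mul, sum_range_choose_eq]

lemma dotProduct_mul_vecMulVec_mul (M N : Matrix ι ι ℝ) (v : ι → ℝ) :
    v ⬝ᵥ ((M * vecMulVec v v * N) *ᵥ v) = (v ⬝ᵥ (M *ᵥ v)) * (v ⬝ᵥ (N *ᵥ v)) := by
  rw [← mulVec_mulVec, ← mulVec_mulVec, vecMulVec_mulVec, mulVec_smul, dotProduct_smul]
  simp

lemma trace_mul_vecMulVec_mul (M N : Matrix ι ι ℝ) (v : ι → ℝ) :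
    (M * vecMulVec v v * N).trace = v ⬝ᵥ ((N * M) *ᵥ v) := by
  rw [trace_mul_cycle, mul_vecMulVec, trace_vecMulVec, dotProduct_comm]

/-- Perturbation of the moments of `A` by the rank one matrix `v vᵀ`. -/
lemma dotProduct_add_vecMulVec_pow_mul_le {A : Matrix ι ι ℝ} (hA : A.PosSemidef) (v : ι → ℝ)
    (r i : ℕ) :
    v ⬝ᵥ (((A + vecMulVec v v) ^ r * A ^ i) *ᵥ v) ≤
      ∑ j ∈ range (r + 1), (r.choose j : ℝ) *
        ((v ⬝ᵥ v) ^ j * (v ⬝ᵥ (A ^ (i + r - j) *ᵥ v))) := by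
  -- The telescoped expansion involves every lower power of `A + vvᵀ`, each without a trailing power
  -- of `A`; hence strong induction, used at `i = 0`.
  induction r using Nat.strong_induction_on generalizing i with
  | _ r ih =>
  set B := vecMulVec v v with hB
  set a : ℕ → ℝ := fun i => v ⬝ᵥ (A ^ i *ᵥ v) with ha
  have hs : 0 ≤ v ⬝ᵥ v := by simpa using dotProduct_star_self_nonneg v
  have ha0 : ∀ i, 0 ≤ a i := dotProduct_pow_mulVec_nonneg hA v
  have step : v ⬝ᵥ (((A + B) ^ r * A ^ i) *ᵥ v) = a (i + r) +
      ∑ l ∈ range r, (v ⬝ᵥ ((A + B) ^ l *ᵥ v)) * a (r - 1 - l + i) := by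
    conv_lhs => rw [add_pow_eq_left, add_mul, sum_mul, add_mulVec, sum_mulVec, dotProduct_add,
      dotProduct_sum, ← pow_add, add_comm r]
    simp only [mul_assoc _ (A ^ _) (A ^ i), ← pow_add, hB, dotProduct_mul_vecMulVec_mul, ha]
  rw [step, sum_range_succ']
  have bound : ∑ l ∈ range r, (v ⬝ᵥ ((A + B) ^ l *ᵥ v)) * a (r - 1 - l + i) ≤
      ∑ l ∈ range r, ∑ j ∈ range (l + 1), (l.choose j : ℝ) *
        ((v ⬝ᵥ v) ^ (j + 1) * a (i + r - (j + 1))) := by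
    refine sum_le_sum fun l hl => ?_
    rw [mem_range] at hl
    have h1 := ih l hl 0
    rw [pow_zero, mul_one] at h1
    refine (mul_le_mul_of_nonneg_right h1 (ha0 _)).trans ?_
    rw [sum_mul]
    refine sum_le_sum fun j hj => ?_
    rw [mem_range] at hj
    -- Chebyshev merges two moments into one, at the cost of one factor `v ⬝ᵥ v`.
    have h2 := dotProduct_pow_mul_dotProduct_pow_le hA v (0 + l - j) (r - 1 - l + i)
    rw [show 0 + l - j + (r - 1 - l + i) = i + r - (j + 1) by omega] at h2
    have h3 := mul_le_mul_of_nonneg_left h2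
      (show 0 ≤ (l.choose j : ℝ) * (v ⬝ᵥ v) ^ j by positivity)
    calc _ = (l.choose j : ℝ) * (v ⬝ᵥ v) ^ j * ((v ⬝ᵥ (A ^ (0 + l - j) *ᵥ v)) *
          (v ⬝ᵥ (A ^ (r - 1 - l + i) *ᵥ v))) := by simp only [ha]; ring
      _ ≤ _ := h3
      _ = _ := by simp only [ha]; ring
  rw [sum_sum_choose_mul r (fun j => (v ⬝ᵥ v) ^ (j + 1) * a (i + r - (j + 1)))] at bound
  simp only [Nat.choose_zero_right, Nat.cast_one, pow_zero, one_mul, Nat.sub_zero]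
  simp only [ha] at bound ⊢
  linarith

/-- The rank one Golden–Thompson inequality, coefficientwise. -/
lemma trace_add_vecMulVec_pow_le {A : Matrix ι ι ℝ} (hA : A.PosSemidef) (v : ι → ℝ) (m : ℕ) :
    ((A + vecMulVec v v) ^ m).trace ≤ (A ^ m).trace +
      ∑ j ∈ range m, (m.choose (j + 1) : ℝ) *
        ((v ⬝ᵥ v) ^ j * (A ^ (m - 1 - j) * vecMulVec v v).trace) := by
  conv_lhs => rw [add_pow_eq_right, trace_add, trace_sum]
  rw [← sum_sum_choose_mul m
    (fun j => (v ⬝ᵥ v) ^ j * (A ^ (m - 1 - j) * vecMulVec v v).trace)]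
  gcongr with l hl
  rw [mem_range] at hl
  rw [trace_mul_vecMulVec_mul]
  refine (dotProduct_add_vecMulVec_pow_mul_le hA v l (m - 1 - l)).trans (le_of_eq ?_)
  refine sum_congr rfl fun j hj => ?_
  rw [mul_vecMulVec, trace_vecMulVec, dotProduct_comm (A ^ _ *ᵥ v) v,
    show m - 1 - l + l - j = m - 1 - j by omega]

open scoped MatrixOrder Matrix.Norms.L2Operator in
-- With `A = Dᴴ D`, cyclicity gives the trace of `D B Dᴴ`, which is positive semidefinite.
lemma trace_mul_nonneg {A B : Matrix ι ι ℝ} (hA : A.PosSemidef) (hB : B.PosSemidef) :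
    0 ≤ (A * B).trace := by
  obtain ⟨D, rfl⟩ := CStarAlgebra.nonneg_iff_eq_star_mul_self.mp hA.nonneg
  rw [trace_mul_cycle, trace_mul_comm, ← mul_assoc]
  exact (hB.mul_mul_conjTranspose_same D).trace_nonneg

/-- Jensen's inequality for the spectral measure of `x`, here by iterating Chebyshev, followed by
`xxᵀ ≤ I` (Cauchy–Schwarz). It converts a large quadratic form into a large trace moment. -/
lemma pow_le_trace_pow {A : Matrix ι ι ℝ} (hA : A.PosSemidef) {x : ι → ℝ} (hx : x ⬝ᵥ x = 1)
    (m : ℕ) : (x ⬝ᵥ (A *ᵥ x)) ^ m ≤ (A ^ m).trace := by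
  have h1 : (x ⬝ᵥ (A *ᵥ x)) ^ m ≤ x ⬝ᵥ (A ^ m *ᵥ x) := by
    induction m with
    | zero => simp [hx]
    | succ m ih =>
      have h := dotProduct_pow_mul_dotProduct_pow_le hA x m 1
      rw [hx, one_mul, pow_one] at h
      rw [pow_succ]
      exact (mul_le_mul_of_nonneg_right ih
        (by simpa using dotProduct_pow_mulVec_nonneg hA x 1)).trans h
  have h2 : (1 - vecMulVec x x).PosSemidef := by
    refine PosSemidef.of_dotProduct_mulVec_nonneg ?_ fun y => ?_
    · ext i j
      simp [vecMulVec_apply, one_apply, mul_comm, eq_comm]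
    · have h3 : (∑ i, y i * x i) ^ 2 ≤ (∑ i, y i ^ 2) * ∑ i, x i ^ 2 :=
        sum_mul_sq_le_sq_mul_sq _ _ _
      have hx' : ∑ i, x i ^ 2 = 1 := by simpa [dotProduct, sq] using hx
      rw [hx', mul_one] at h3
      simp only [star_trivial, sub_mulVec, one_mulVec, dotProduct_sub, vecMulVec_mulVec,
        dotProduct_smul]
      have h4 : y ⬝ᵥ y = ∑ i, y i ^ 2 := by simp [dotProduct, sq]
      have h5 : (x ⬝ᵥ y) = ∑ i, y i * x i := by rw [dotProduct_comm]; rfl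
      have h6 : (y ⬝ᵥ x) = ∑ i, y i * x i := rfl
      simp only [op_smul_eq_smul, smul_eq_mul]
      rw [h4, h5, h6]
      linarith [sq (∑ i, y i * x i)]
  have h3 := trace_mul_nonneg (hA.pow m) h2
  rw [mul_sub, mul_one, trace_sub, mul_vecMulVec, trace_vecMulVec, dotProduct_comm] at h3
  linarith

lemma le_lambdaMax {A : Matrix ι ι ℝ} (hA : A.IsHermitian) (i : ι) :
    hA.eigenvalues i ≤ lambdaMax A := by
  refine le_csSup ?_ (hA.eigenvalues_mem_spectrum_real i)
  rw [hA.spectrum_real_eq_range_eigenvalues]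
  exact (Set.finite_range _).bddAbove

lemma posSemidef_lambdaMax_smul_one_sub {A : Matrix ι ι ℝ} (hA : A.IsHermitian) :
    (lambdaMax A • (1 : Matrix ι ι ℝ) - A).PosSemidef := by
  refine PosSemidef.of_dotProduct_mulVec_nonneg ?_ fun v => ?_
  · refine IsHermitian.sub ?_ hA
    ext i j
    simp [one_apply, eq_comm]
  obtain ⟨c, hc⟩ := exists_dotProduct_pow_mulVec_eq hA v
  have h0 : v ⬝ᵥ v = ∑ l, c l ^ 2 := by simpa using hc 0
  have h1 : v ⬝ᵥ (A *ᵥ v) = ∑ l, c l ^ 2 * hA.eigenvalues l := by simpa using hc 1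
  simp only [star_trivial, sub_mulVec, smul_mulVec, one_mulVec, dotProduct_sub, dotProduct_smul,
    smul_eq_mul, h0, h1, mul_sum]
  rw [sub_nonneg]
  exact sum_le_sum fun l _ => by
    rw [mul_comm]; exact mul_le_mul_of_nonneg_right (le_lambdaMax hA l) (sq_nonneg _)

lemma trace_mul_le_lambdaMax_mul_trace {A C : Matrix ι ι ℝ} (hA : A.PosSemidef)
    (hC : C.IsHermitian) : (A * C).trace ≤ lambdaMax C * A.trace := by
  have h := trace_mul_nonneg hA (posSemidef_lambdaMax_smul_one_sub hC)
  rw [mul_sub, trace_sub, mul_smul_comm, mul_one, trace_smul, smul_eq_mul] at h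
  linarith

lemma lambdaMax_pos {C : Matrix ι ι ℝ} (hC : C.PosSemidef) (h0 : C ≠ 0) : 0 < lambdaMax C := by
  by_contra! h
  refine h0 (hC.1.eigenvalues_eq_zero_iff.1 ?_)
  ext i
  exact le_antisymm ((le_lambdaMax hC.1 i).trans h) (hC.eigenvalues_nonneg i)

end LinearAlgebra

/-! ### Truncated exponential generating functions. -/

section ExpSeries

/-- A truncated exponential generating function whose coefficients satisfy a binomial recursion
grows by at most the corresponding exponential factor. -/
lemma sum_pow_div_factorial_mul_le {α α' : ℕ → ℝ} {t R θ : ℝ} (ht : 0 ≤ t) (hR : 0 < R)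
    (hθ : 0 ≤ θ) (hα : ∀ m, 0 ≤ α m)
    (h : ∀ m, α' m ≤ α m + ∑ j ∈ range m, (m.choose (j + 1) : ℝ) * (R ^ j * (θ * α (m - 1 - j))))
    (N : ℕ) :
    ∑ m ∈ range (N + 1), t ^ m / m.factorial * α' m ≤
      (1 + θ * ((Real.exp (t * R) - 1) / R)) *
        ∑ m ∈ range (N + 1), t ^ m / m.factorial * α m := by
  set Z := ∑ m ∈ range (N + 1), t ^ m / m.factorial * α m with hZ
  set b : ℕ → ℝ := fun r => t ^ r / r.factorial * α r with hb
  set g : ℕ → ℝ := fun j => (t * R) ^ (j + 1) / (j + 1).factorial with hg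
  have hb0 : ∀ r, 0 ≤ b r := fun r => mul_nonneg (by positivity) (hα r)
  have hg0 : ∀ r, 0 ≤ g r := fun r => by positivity
  have hgsum : ∑ j ∈ range N, g j ≤ Real.exp (t * R) - 1 := by
    have h1 := Real.sum_le_exp_of_nonneg (mul_nonneg ht hR.le) (N + 1)
    rw [sum_range_succ'] at h1
    simp only [pow_zero, Nat.factorial_zero, Nat.cast_one, div_one] at h1
    linarith
  -- The binomial coefficient splits the factorial, so the recursion becomes a Cauchy product of the
  -- series of `exp (t R) - 1` and of `α`.
  have term : ∀ m j, j ≤ m → t ^ (m + 1) / (m + 1).factorial *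
      (((m + 1).choose (j + 1) : ℝ) * (R ^ j * (θ * α (m - j)))) =
      θ / R * (g j * b (m - j)) := by
    intro m j hj
    obtain ⟨r, rfl⟩ := Nat.exists_eq_add_of_le hj
    have hc : ((j + r + 1).choose (j + 1) : ℝ) * (j + 1).factorial * r.factorial =
        (j + r + 1).factorial := by
      have := Nat.choose_mul_factorial_mul_factorial (show j + 1 ≤ j + r + 1 by omega)
      rw [show j + r + 1 - (j + 1) = r by omega] at this
      exact_mod_cast this
    have f1 : ((j + 1).factorial : ℝ) ≠ 0 := by positivity
    have f2 : (r.factorial : ℝ) ≠ 0 := by positivity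
    have f3 : ((j + r + 1).factorial : ℝ) ≠ 0 := by positivity
    simp only [hg, hb, Nat.add_sub_cancel_left]
    field_simp
    rw [← hc]
    ring
  have cross : ∑ m ∈ range (N + 1), t ^ m / m.factorial *
      ∑ j ∈ range m, (m.choose (j + 1) : ℝ) * (R ^ j * (θ * α (m - 1 - j))) ≤
      θ / R * ((Real.exp (t * R) - 1) * Z) := by
    rw [sum_range_succ']
    simp only [range_zero, sum_empty, mul_zero, add_zero, Nat.add_sub_cancel]
    have e1 : ∑ m ∈ range N, t ^ (m + 1) / (m + 1).factorial *
        ∑ j ∈ range (m + 1), ((m + 1).choose (j + 1) : ℝ) * (R ^ j * (θ * α (m - j))) =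
        θ / R * ∑ m ∈ range N, ∑ j ∈ range (m + 1), g j * b (m - j) := by
      simp only [mul_sum]
      refine sum_congr rfl fun m _ => sum_congr rfl fun j hj => ?_
      rw [mem_range] at hj
      simpa only [mul_sum] using term m j (by omega)
    -- All terms are nonnegative, so the triangular sum is at most the product of the two truncated
    -- sums.
    rw [e1, sum_range_diag_flip N fun j r => g j * b r]
    refine mul_le_mul_of_nonneg_left ?_ (by positivity)
    calc ∑ j ∈ range N, ∑ r ∈ range (N - j), g j * b r ≤ ∑ j ∈ range N, g j * Z := by
          refine sum_le_sum fun j _ => ?_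
          rw [← mul_sum]
          refine mul_le_mul_of_nonneg_left ?_ (hg0 j)
          exact sum_le_sum_of_subset_of_nonneg (range_subset_range.2 (by omega)) fun r _ _ => hb0 r
      _ ≤ _ := by
          rw [← sum_mul]
          exact mul_le_mul_of_nonneg_right hgsum (sum_nonneg fun r _ => hb0 r)
  calc ∑ m ∈ range (N + 1), t ^ m / m.factorial * α' m
      ≤ ∑ m ∈ range (N + 1), (t ^ m / m.factorial * α m + t ^ m / m.factorial *
        ∑ j ∈ range m, (m.choose (j + 1) : ℝ) * (R ^ j * (θ * α (m - 1 - j)))) := by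
        refine sum_le_sum fun m _ => ?_
        rw [← mul_add]
        exact mul_le_mul_of_nonneg_left (h m) (by positivity)
    _ ≤ Z + θ / R * ((Real.exp (t * R) - 1) * Z) := by
        rw [sum_add_distrib]
        linarith
    _ = _ := by ring

end ExpSeries

/-! ### Matrix Chernoff bound for sums of independent rank one matrices. -/

section Chernoff

variable {Ω : Type*} [MeasurableSpace Ω] {P : Measure Ω} [IsProbabilityMeasure P]
  {ι κ : Type*} [Fintype ι] [DecidableEq ι]

/-- The Gram sum `∑ i ∈ s, wᵢ wᵢᵀ`. -/
def gram (w : κ → ι → ℝ) (s : Finset κ) : Matrix ι ι ℝ := ∑ i ∈ s, vecMulVec (w i) (w i)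

lemma gram_posSemidef (w : κ → ι → ℝ) (s : Finset κ) : (gram w s).PosSemidef :=
  posSemidef_sum s fun i _ => by simpa using posSemidef_vecMulVec_self_star (w i)

lemma dotProduct_gram_mulVec (w : κ → ι → ℝ) (s : Finset κ) (x : ι → ℝ) :
    x ⬝ᵥ (gram w s *ᵥ x) = ∑ i ∈ s, (w i ⬝ᵥ x) ^ 2 := by
  rw [gram, sum_mulVec, dotProduct_sum]
  refine sum_congr rfl fun i _ => ?_
  rw [vecMulVec_mulVec, dotProduct_smul, op_smul_eq_smul, smul_eq_mul, dotProduct_comm x, sq]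

lemma measurable_pow_apply (r : ℕ) (j l : ι) :
    Measurable fun M : ι → ι → ℝ => (Matrix.of M ^ r) j l := by
  induction r generalizing j l with
  | zero => simp only [pow_zero]; exact measurable_const
  | succ r ih =>
    simp only [pow_succ, mul_apply, of_apply]
    exact Finset.measurable_fun_sum _ fun q _ =>
      (ih j q).mul ((measurable_pi_apply l).comp (measurable_pi_apply q))

lemma memLp_top_mul {f g : Ω → ℝ} (hf : MemLp f ⊤ P) (hg : MemLp g ⊤ P) :
    MemLp (fun ω => f ω * g ω) ⊤ P :=
  hg.mul hf

section Bounded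

variable {w : κ → Ω → ι → ℝ} {R : ℝ}

lemma memLp_top_apply_mul_apply (hw : ∀ i, AEMeasurable (w i) P)
    (hR : ∀ i, ∀ᵐ ω ∂P, w i ω ⬝ᵥ w i ω ≤ R) (i : κ) (j l : ι) :
    MemLp (fun ω => w i ω j * w i ω l) ⊤ P := by
  have hm : ∀ j, AEMeasurable (fun ω => w i ω j) P := fun j =>
    (measurable_pi_apply j).comp_aemeasurable (hw i)
  refine memLp_top_of_bound ((hm j).mul (hm l)).aestronglyMeasurable R ?_
  filter_upwards [hR i] with ω h
  have h1 : ∀ j, w i ω j * w i ω j ≤ R := fun j =>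
    (single_le_sum (f := fun j => w i ω j * w i ω j) (fun _ _ => mul_self_nonneg _)
      (mem_univ j)).trans h
  rw [Real.norm_eq_abs, abs_le]
  constructor <;> nlinarith [h1 j, h1 l, sq_nonneg (w i ω j + w i ω l),
    sq_nonneg (w i ω j - w i ω l)]

lemma memLp_top_gram_pow_apply (hw : ∀ i, AEMeasurable (w i) P)
    (hR : ∀ i, ∀ᵐ ω ∂P, w i ω ⬝ᵥ w i ω ≤ R) (s : Finset κ) (m : ℕ) (j l : ι) :
    MemLp (fun ω => (gram (fun i => w i ω) s ^ m) j l) ⊤ P := by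
  induction m generalizing j l with
  | zero => simp only [pow_zero]; exact memLp_top_const _
  | succ m ih =>
    simp only [pow_succ, mul_apply]
    refine memLp_finsetSum _ fun q _ => memLp_top_mul (ih j q) ?_
    simp only [gram, Matrix.sum_apply, vecMulVec_apply]
    exact memLp_finsetSum _ fun i _ => memLp_top_apply_mul_apply hw hR i q l

lemma integrable_trace_gram_pow (hw : ∀ i, AEMeasurable (w i) P)
    (hR : ∀ i, ∀ᵐ ω ∂P, w i ω ⬝ᵥ w i ω ≤ R) (s : Finset κ) (m : ℕ) :
    Integrable (fun ω => (gram (fun i => w i ω) s ^ m).trace) P := by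
  simp only [trace, diag_apply]
  exact integrable_finsetSum _ fun j _ =>
    (memLp_top_gram_pow_apply hw hR s m j j).integrable le_top

variable [DecidableEq κ]

lemma integrable_trace_gram_pow_mul (hw : ∀ i, AEMeasurable (w i) P)
    (hR : ∀ i, ∀ᵐ ω ∂P, w i ω ⬝ᵥ w i ω ≤ R) (s : Finset κ) (i : κ) (m : ℕ) :
    Integrable (fun ω => (gram (fun i => w i ω) s ^ m * vecMulVec (w i ω) (w i ω)).trace) P := by
  simp only [trace, diag_apply, mul_apply, vecMulVec_apply]
  exact integrable_finsetSum _ fun j _ => integrable_finsetSum _ fun l _ =>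
    (memLp_top_mul (memLp_top_gram_pow_apply hw hR s m j l)
      (memLp_top_apply_mul_apply hw hR i l j)).integrable le_top

lemma indepFun_gram (hw : ∀ i, AEMeasurable (w i) P) (hind : iIndepFun w P) {s : Finset κ}
    {i : κ} (hi : i ∉ s) :
    IndepFun (fun ω j l => gram (fun i => w i ω) s j l) (fun ω j l => w i ω j * w i ω l) P := by
  have hφ : Measurable fun (v : ι → ℝ) (j l : ι) => v j * v l := by fun_prop
  have h := (hind.comp (fun _ v j l => v j * v l) fun _ => hφ).indepFun_finsetSum_of_notMem₀
    (fun i => hφ.comp_aemeasurable (hw i)) hi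
  refine h.congr (ae_of_all _ fun ω => ?_) (ae_of_all _ fun ω => rfl)
  ext j l
  simp [gram, Matrix.sum_apply, vecMulVec_apply]

variable {C : Matrix ι ι ℝ}

/-- The new summand is independent of the Gram sum over `s`, so entrywise its outer product may be
replaced by its mean `C`; then `C ≤ lambdaMax C • 1` under the trace. -/
lemma integral_trace_gram_pow_mul_le (hw : ∀ i, AEMeasurable (w i) P)
    (hR : ∀ i, ∀ᵐ ω ∂P, w i ω ⬝ᵥ w i ω ≤ R) (hind : iIndepFun w P)
    (hC : ∀ i j l, ∫ ω, w i ω j * w i ω l ∂P = C j l) (hCh : C.IsHermitian) {s : Finset κ}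
    {i : κ} (hi : i ∉ s) (m : ℕ) :
    ∫ ω, (gram (fun i => w i ω) s ^ m * vecMulVec (w i ω) (w i ω)).trace ∂P ≤
      lambdaMax C * ∫ ω, (gram (fun i => w i ω) s ^ m).trace ∂P := by
  have hL := memLp_top_gram_pow_apply hw hR s m
  have hX := memLp_top_apply_mul_apply hw hR i
  have e1 : ∀ j l, ∫ ω, (gram (fun i => w i ω) s ^ m) j l * (w i ω l * w i ω j) ∂P =
      ∫ ω, (gram (fun i => w i ω) s ^ m) j l * C l j ∂P := by
    intro j l
    have hi1 : IndepFun (fun ω => (gram (fun i => w i ω) s ^ m) j l)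
        (fun ω => w i ω l * w i ω j) P :=
      (indepFun_gram hw hind hi).comp (φ := fun M => (Matrix.of M ^ m) j l)
        (ψ := fun M : ι → ι → ℝ => M l j) (measurable_pow_apply m j l) (by fun_prop)
    rw [hi1.integral_fun_mul_eq_mul_integral (hL j l).1 (hX l j).1, hC, integral_mul_const]
  have e2 : ∫ ω, (gram (fun i => w i ω) s ^ m * vecMulVec (w i ω) (w i ω)).trace ∂P =
      ∫ ω, (gram (fun i => w i ω) s ^ m * C).trace ∂P := by
    simp only [trace, diag_apply, mul_apply, vecMulVec_apply]
    rw [integral_finsetSum _ fun j _ => integrable_finsetSum _ fun l _ =>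
        (memLp_top_mul (hL j l) (hX l j)).integrable le_top,
      integral_finsetSum _ fun j _ => integrable_finsetSum _ fun l _ =>
        ((hL j l).integrable le_top).mul_const _]
    refine sum_congr rfl fun j _ => ?_
    rw [integral_finsetSum _ fun l _ => (memLp_top_mul (hL j l) (hX l j)).integrable le_top,
      integral_finsetSum _ fun l _ => ((hL j l).integrable le_top).mul_const _]
    exact sum_congr rfl fun l _ => e1 j l
  rw [e2, ← integral_const_mul]
  refine integral_mono ?_ ((integrable_trace_gram_pow hw hR s m).const_mul _) fun ω =>
    trace_mul_le_lambdaMax_mul_trace ((gram_posSemidef _ s).pow m) hCh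
  simp only [trace, diag_apply, mul_apply]
  exact integrable_finsetSum _ fun j _ => integrable_finsetSum _ fun l _ =>
    ((hL j l).integrable le_top).mul_const _

lemma integral_trace_gram_insert_pow_le (hw : ∀ i, AEMeasurable (w i) P)
    (hR : ∀ i, ∀ᵐ ω ∂P, w i ω ⬝ᵥ w i ω ≤ R) (hR0 : 0 ≤ R) (hind : iIndepFun w P)
    (hC : ∀ i j l, ∫ ω, w i ω j * w i ω l ∂P = C j l) (hCh : C.IsHermitian) {s : Finset κ}
    {i : κ} (hi : i ∉ s) (m : ℕ) :
    ∫ ω, (gram (fun i => w i ω) (insert i s) ^ m).trace ∂P ≤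
      ∫ ω, (gram (fun i => w i ω) s ^ m).trace ∂P +
        ∑ j ∈ range m, (m.choose (j + 1) : ℝ) * (R ^ j *
          (lambdaMax C * ∫ ω, (gram (fun i => w i ω) s ^ (m - 1 - j)).trace ∂P)) := by
  have hI : ∀ j, Integrable (fun ω => (m.choose (j + 1) : ℝ) * (R ^ j *
      (gram (fun i => w i ω) s ^ (m - 1 - j) * vecMulVec (w i ω) (w i ω)).trace)) P := fun j =>
    ((integrable_trace_gram_pow_mul hw hR s i _).const_mul _).const_mul _
  calc ∫ ω, (gram (fun i => w i ω) (insert i s) ^ m).trace ∂P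
      ≤ ∫ ω, ((gram (fun i => w i ω) s ^ m).trace +
        ∑ j ∈ range m, (m.choose (j + 1) : ℝ) * (R ^ j *
          (gram (fun i => w i ω) s ^ (m - 1 - j) * vecMulVec (w i ω) (w i ω)).trace)) ∂P := by
        refine integral_mono_ae (integrable_trace_gram_pow hw hR _ m)
          ((integrable_trace_gram_pow hw hR s m).add (integrable_finsetSum _ fun j _ => hI j)) ?_
        filter_upwards [hR i] with ω hω
        have e : gram (fun i => w i ω) (insert i s) =
            gram (fun i => w i ω) s + vecMulVec (w i ω) (w i ω) := by
          rw [gram, sum_insert hi, add_comm]; rfl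
        rw [e]
        refine (trace_add_vecMulVec_pow_le (gram_posSemidef _ s) (w i ω) m).trans ?_
        gcongr with j _
        · exact trace_mul_nonneg ((gram_posSemidef _ s).pow _)
            (by simpa using posSemidef_vecMulVec_self_star (w i ω))
        · simpa using dotProduct_star_self_nonneg (w i ω)
    _ = ∫ ω, (gram (fun i => w i ω) s ^ m).trace ∂P +
        ∑ j ∈ range m, (m.choose (j + 1) : ℝ) * (R ^ j *
          ∫ ω, (gram (fun i => w i ω) s ^ (m - 1 - j) * vecMulVec (w i ω) (w i ω)).trace ∂P) := by
        rw [integral_add (integrable_trace_gram_pow hw hR s m)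
          (integrable_finsetSum _ fun j _ => hI j), integral_finsetSum _ fun j _ => hI j]
        simp only [integral_const_mul]
    _ ≤ _ := by
        gcongr with j _
        exact integral_trace_gram_pow_mul_le hw hR hind hC hCh hi _

/-- One growth factor per summand, by induction on `s`. For the empty sum only the degree zero term
survives, and it equals the dimension. -/
lemma sum_integral_trace_gram_pow_le (hw : ∀ i, AEMeasurable (w i) P)
    (hR : ∀ i, ∀ᵐ ω ∂P, w i ω ⬝ᵥ w i ω ≤ R) (hR0 : 0 < R) (hind : iIndepFun w P)
    (hC : ∀ i j l, ∫ ω, w i ω j * w i ω l ∂P = C j l) (hCh : C.IsHermitian)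
    (hθ : 0 ≤ lambdaMax C) {t : ℝ} (ht : 0 ≤ t) (s : Finset κ) (N : ℕ) :
    ∑ m ∈ range (N + 1), t ^ m / m.factorial * ∫ ω, (gram (fun i => w i ω) s ^ m).trace ∂P ≤
      (1 + lambdaMax C * ((Real.exp (t * R) - 1) / R)) ^ s.card * Fintype.card ι := by
  have hpos : 0 ≤ 1 + lambdaMax C * ((Real.exp (t * R) - 1) / R) := by
    have : 1 ≤ Real.exp (t * R) := Real.one_le_exp (by positivity)
    have : 0 ≤ (Real.exp (t * R) - 1) / R := div_nonneg (by linarith) hR0.le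
    positivity
  induction s using Finset.induction_on with
  | empty =>
    rw [sum_range_succ']
    simp [gram]
  | insert i s hi ih =>
    refine (sum_pow_div_factorial_mul_le ht hR0 hθ
      (fun m => integral_nonneg fun ω => ((gram_posSemidef _ s).pow m).trace_nonneg)
      (fun m => integral_trace_gram_insert_pow_le hw hR hR0.le hind hC hCh hi m) N).trans ?_
    rw [card_insert_of_notMem hi, pow_succ', mul_assoc]
    exact mul_le_mul_of_nonneg_left ih hpos

/-- The matrix Chernoff bound for a sum of independent rank one matrices. -/
theorem measureReal_lt_dotProduct_gram_le (hw : ∀ i, AEMeasurable (w i) P)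
    (hR : ∀ i, ∀ᵐ ω ∂P, w i ω ⬝ᵥ w i ω ≤ R) (hR0 : 0 < R) (hind : iIndepFun w P)
    (hC : ∀ i j l, ∫ ω, w i ω j * w i ω l ∂P = C j l) (hCh : C.IsHermitian)
    (hθ : 0 ≤ lambdaMax C) {τ : ℝ} (hτ : 0 ≤ τ) (s : Finset κ) :
    P.real {ω | ∃ x : ι → ℝ, x ⬝ᵥ x = 1 ∧ (1 + τ) * (s.card * lambdaMax C) <
        x ⬝ᵥ (gram (fun i => w i ω) s *ᵥ x)} ≤
      Fintype.card ι * Real.exp (-(s.card * lambdaMax C * h τ / R)) := by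
  set θ := lambdaMax C
  set q := (1 + τ) * (s.card * θ) with hq
  have hq0 : 0 ≤ q := by positivity
  -- The minimizer of the Chernoff exponent, for which `exp (t R) - 1 = τ`.
  set t := Real.log (1 + τ) / R with ht'
  have ht : 0 ≤ t := div_nonneg (Real.log_nonneg (by linarith)) hR0.le
  have htR : Real.exp (t * R) - 1 = τ := by
    rw [ht', div_mul_cancel₀ _ hR0.ne', Real.exp_log (by linarith)]; ring
  set E := {ω | ∃ x : ι → ℝ, x ⬝ᵥ x = 1 ∧ q < x ⬝ᵥ (gram (fun i => w i ω) s *ᵥ x)} with hE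
  have key : ∀ N : ℕ, (∑ m ∈ range (N + 1), (t * q) ^ m / m.factorial) * P.real E ≤
      (1 + θ * (τ / R)) ^ s.card * Fintype.card ι := by
    intro N
    rw [← htR]
    refine le_trans ?_ (sum_integral_trace_gram_pow_le hw hR hR0 hind hC hCh hθ ht s N)
    have hint : ∀ m ∈ range (N + 1), Integrable (fun ω => t ^ m / m.factorial *
        (gram (fun i => w i ω) s ^ m).trace) P := fun m _ =>
      (integrable_trace_gram_pow hw hR s m).const_mul _
    -- Markov's inequality at the level of the truncated series of `exp (t q)`: on `E` the trace
    -- moment of each degree `m` is at least `q ^ m`.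
    have hM := mul_meas_ge_le_integral_of_nonneg (μ := P)
      (f := fun ω => ∑ m ∈ range (N + 1), t ^ m / m.factorial *
        (gram (fun i => w i ω) s ^ m).trace)
      (Filter.Eventually.of_forall fun ω => sum_nonneg fun m _ => mul_nonneg (by positivity)
        ((gram_posSemidef _ s).pow m).trace_nonneg)
      (integrable_finsetSum _ hint) (∑ m ∈ range (N + 1), (t * q) ^ m / m.factorial)
    rw [integral_finsetSum _ hint] at hM
    simp only [integral_const_mul] at hM
    refine le_trans (mul_le_mul_of_nonneg_left (measureReal_mono ?_)
      (sum_nonneg fun m _ => by positivity)) hM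
    rintro ω ⟨x, hx, hlt⟩
    rw [Set.mem_ofPred_eq]
    refine sum_le_sum fun m _ => ?_
    rw [mul_pow, mul_div_right_comm]
    refine mul_le_mul_of_nonneg_left ?_ (by positivity)
    exact (pow_le_pow_left₀ hq0 hlt.le m).trans (pow_le_trace_pow (gram_posSemidef _ s) hx m)
  have hlim : Filter.Tendsto (fun N : ℕ => ∑ m ∈ range (N + 1), (t * q) ^ m / m.factorial)
      Filter.atTop (nhds (Real.exp (t * q))) := by
    have h1 := (NormedSpace.expSeries_div_hasSum_exp (t * q)).tendsto_sum_nat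
    rw [← Real.exp_eq_exp_ℝ] at h1
    exact h1.comp (Filter.tendsto_add_atTop_nat 1)
  have h1 := le_of_tendsto' (hlim.mul_const (P.real E)) key
  have h2 : (1 + θ * (τ / R)) ^ s.card ≤ Real.exp (s.card * (θ * (τ / R))) := by
    rw [Real.exp_nat_mul]
    refine pow_le_pow_left₀ (by positivity) ?_ _
    rw [add_comm]
    exact Real.add_one_le_exp _
  have h3 := h1.trans (mul_le_mul_of_nonneg_right h2 (Nat.cast_nonneg (Fintype.card ι)))
  rw [mul_comm (Real.exp (t * q)), ← le_div_iff₀ (Real.exp_pos _)] at h3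
  refine h3.trans (le_of_eq ?_)
  rw [mul_comm, mul_div_assoc, ← Real.exp_sub]
  congr 2
  rw [ht', hq, h]
  field_simp
  ring

end Bounded

end Chernoff

/-! ### The Hessian of the regularized logistic loss. -/

section Hessian

variable {p n : ℕ}

/-- The Hessian form is the second derivative along the line `x + t • Δ`, which reduces its
computation to one-variable calculus. -/
lemma hessianForm_eq_of_hasDerivAt {f : EuclideanSpace ℝ (Fin p) → ℝ} (hf : ContDiff ℝ 2 f)
    {x Δ : EuclideanSpace ℝ (Fin p)} {φ : ℝ → ℝ} {c : ℝ}
    (h₁ : ∀ t, HasDerivAt (fun t : ℝ => f (x + t • Δ)) (φ t) t) (h₂ : HasDerivAt φ c 0) :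
    hessianForm f x Δ = c := by
  have hline : ∀ t : ℝ, HasDerivAt (fun t : ℝ => x + t • Δ) Δ t := fun t => by
    simpa using ((hasDerivAt_id t).smul_const Δ).const_add x
  have hφ : φ = fun t => fderiv ℝ f (x + t • Δ) Δ := by
    ext t
    exact (h₁ t).unique
      (((hf.differentiable (by norm_num)) _).hasFDerivAt.comp_hasDerivAt t (hline t))
  have hd : Differentiable ℝ (fderiv ℝ f) :=
    (hf.fderiv_right (m := 1) (by norm_num)).differentiable (by norm_num)
  rw [hφ] at h₂
  refine HasDerivAt.unique ?_ h₂
  unfold hessianForm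
  generalize fderiv ℝ f = G at hd
  have h₀ : HasFDerivAt G (fderiv ℝ G x) (x + (0 : ℝ) • Δ) := by
    rw [zero_smul, add_zero]
    exact (hd x).hasFDerivAt
  exact (ContinuousLinearMap.apply ℝ ℝ Δ).hasFDerivAt.comp_hasDerivAt 0
    (h₀.comp_hasDerivAt 0 (hline 0))

lemma contDiff_regLogisticLoss (η : ℝ) (a : Fin n → EuclideanSpace ℝ (Fin p)) (y : Fin n → ℝ) :
    ContDiff ℝ 2 (regLogisticLoss η a y) := by
  unfold regLogisticLoss logisticLoss
  refine ContDiff.add (contDiff_const.mul (ContDiff.sum fun i _ => ContDiff.sub ?_ ?_))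
    (contDiff_const.mul (contDiff_norm_sq ℝ))
  · exact (contDiff_const.add (contDiff_const.inner ℝ contDiff_id).exp).log
      fun x => by positivity
  · exact contDiff_const.mul (contDiff_const.inner ℝ contDiff_id)

lemma hasDerivAt_log_one_add_exp (u : ℝ) :
    HasDerivAt (fun u => Real.log (1 + Real.exp u)) (Real.exp u / (1 + Real.exp u)) u :=
  ((Real.hasDerivAt_exp u).const_add 1).log (by positivity)

lemma hasDerivAt_exp_div_one_add_exp (u : ℝ) :
    HasDerivAt (fun u => Real.exp u / (1 + Real.exp u)) (Real.exp u / (1 + Real.exp u) ^ 2) u := by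
  exact ((Real.hasDerivAt_exp u).div ((Real.hasDerivAt_exp u).const_add 1)
    (by positivity)).congr_deriv (by ring)

lemma exp_div_one_add_exp_sq_le (u : ℝ) : Real.exp u / (1 + Real.exp u) ^ 2 ≤ 1 / 4 := by
  rw [div_le_div_iff₀ (by positivity) (by norm_num)]
  nlinarith [sq_nonneg (1 - Real.exp u)]

lemma hessianForm_regLogisticLoss (η : ℝ) (a : Fin n → EuclideanSpace ℝ (Fin p))
    (y : Fin n → ℝ) (x Δ : EuclideanSpace ℝ (Fin p)) :
    hessianForm (regLogisticLoss η a y) x Δ =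
      (1 / (n : ℝ)) * ∑ i, Real.exp (inner ℝ (a i) x) / (1 + Real.exp (inner ℝ (a i) x)) ^ 2 *
        inner ℝ (a i) Δ ^ 2 + η * ‖Δ‖ ^ 2 := by
  have hu : ∀ i (t : ℝ), HasDerivAt (fun t : ℝ => inner ℝ (a i) x + t * inner ℝ (a i) Δ)
      (inner ℝ (a i) Δ) t := fun i t => by
    simpa using ((hasDerivAt_id t).mul_const (inner ℝ (a i) Δ)).const_add (inner ℝ (a i) x)
  refine hessianForm_eq_of_hasDerivAt (contDiff_regLogisticLoss η a y)
    (φ := fun t => (1 / (n : ℝ)) * ∑ i,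
      (Real.exp (inner ℝ (a i) x + t * inner ℝ (a i) Δ) /
        (1 + Real.exp (inner ℝ (a i) x + t * inner ℝ (a i) Δ)) * inner ℝ (a i) Δ -
          y i * inner ℝ (a i) Δ) + η / 2 * (2 * inner ℝ x Δ + 2 * t * ‖Δ‖ ^ 2)) (fun t => ?_) ?_
  · have e : (fun t : ℝ => regLogisticLoss η a y (x + t • Δ)) = fun t : ℝ =>
        (1 / (n : ℝ)) * ∑ i, (Real.log (1 + Real.exp (inner ℝ (a i) x + t * inner ℝ (a i) Δ)) -
          y i * (inner ℝ (a i) x + t * inner ℝ (a i) Δ)) +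
        η / 2 * (‖x‖ ^ 2 + 2 * inner ℝ x Δ * t + ‖Δ‖ ^ 2 * t ^ 2) := by
      ext t
      simp only [regLogisticLoss, logisticLoss, inner_add_right, inner_smul_right,
        norm_add_sq_real, norm_smul, mul_pow, Real.norm_eq_abs, sq_abs]
      ring
    rw [e]
    refine HasDerivAt.add (HasDerivAt.const_mul _ (HasDerivAt.fun_sum fun i _ => ?_))
      (HasDerivAt.const_mul _ ?_)
    · exact ((hasDerivAt_log_one_add_exp _).comp t (hu i t)).sub ((hu i t).const_mul (y i))
    · have h := (((hasDerivAt_id t).const_mul (2 * inner ℝ x Δ)).const_add (‖x‖ ^ 2)).add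
        ((hasDerivAt_pow 2 t).const_mul (‖Δ‖ ^ 2))
      exact h.congr_deriv (by simp; ring)
  · refine HasDerivAt.add (HasDerivAt.const_mul _ (HasDerivAt.fun_sum fun i _ => ?_)) ?_
    · have h := ((hasDerivAt_exp_div_one_add_exp _).comp 0 (hu i 0)).mul_const (inner ℝ (a i) Δ)
      exact (h.sub_const (y i * inner ℝ (a i) Δ)).congr_deriv (by simp; ring)
    · have h := ((((hasDerivAt_id (0 : ℝ)).const_mul 2).mul_const (‖Δ‖ ^ 2)).const_add
        (2 * inner ℝ x Δ)).const_mul (η / 2)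
      exact h.congr_deriv (by ring)

end Hessian

/-! ### From Gram bounds to the stable restricted Hessian property. -/

section Restricted

variable {p n k : ℕ}

lemma sum_coe_eq_of_supp_subset {J : Finset (Fin p)} {Δ : EuclideanSpace ℝ (Fin p)}
    (hJ : supp Δ ⊆ J) (b : EuclideanSpace ℝ (Fin p)) :
    (fun j : J => b j) ⬝ᵥ (fun j : J => Δ j) = inner ℝ b Δ := by
  have h : inner ℝ b Δ = ∑ j, b j * Δ j := by
    simp [PiLp.inner_apply, mul_comm]
  rw [h, dotProduct, sum_coe_sort J fun j => b j * Δ j]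
  refine sum_subset (subset_univ J) fun j _ hj => ?_
  have : Δ j = 0 := by
    by_contra h0
    exact hj (hJ (by simp [supp, h0]))
  simp [this]

lemma exists_mem_restrictedCurvatures (hk : 1 ≤ k) (hkp : k ≤ p)
    (f : EuclideanSpace ℝ (Fin p) → ℝ) {x : EuclideanSpace ℝ (Fin p)} (hx : (supp x).card ≤ k) :
    (restrictedCurvatures f k x).Nonempty := by
  obtain ⟨J, hxJ, -, hJ⟩ := exists_subsuperset_card_eq (subset_univ (supp x)) hx
    (by simpa using hkp)
  obtain ⟨j, hj⟩ : J.Nonempty := card_pos.1 (by omega)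
  refine ⟨_, EuclideanSpace.single j 1, ?_, by simp, rfl⟩
  rw [← hJ]
  refine card_le_card (union_subset hxJ fun l hl => ?_)
  have : l = j := by
    by_contra hlj
    simp [supp, hlj] at hl
  rwa [this]

lemma hasSRH_of_forall_gram_le (hk : 1 ≤ k) (hkp : k ≤ p) {η B : ℝ} (hη : 0 < η) (hB : 0 ≤ B)
    (a : Fin n → EuclideanSpace ℝ (Fin p)) (y : Fin n → ℝ)
    (h : ∀ J : Finset (Fin p), J.card = k → ∀ x : J → ℝ, x ⬝ᵥ x = 1 →
      x ⬝ᵥ (gram (fun i (j : J) => a i j) univ *ᵥ x) ≤ n * B) :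
    HasSRH (regLogisticLoss η a y) k (1 + B / (4 * η)) := by
  refine ⟨contDiff_regLogisticLoss η a y, fun x hx => ?_⟩
  set S := restrictedCurvatures (regLogisticLoss η a y) k x
  have hne : S.Nonempty := exists_mem_restrictedCurvatures hk hkp _ hx
  have hlow : ∀ q ∈ S, η ≤ q := by
    rintro q ⟨Δ, -, hΔ, rfl⟩
    rw [hessianForm_regLogisticLoss, hΔ, one_pow, mul_one]
    have : 0 ≤ (1 / (n : ℝ)) * ∑ i, Real.exp (inner ℝ (a i) x) /
      (1 + Real.exp (inner ℝ (a i) x)) ^ 2 * inner ℝ (a i) Δ ^ 2 := by positivity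
    linarith
  have hupp : ∀ q ∈ S, q ≤ η + B / 4 := by
    rintro q ⟨Δ, hcard, hΔ, rfl⟩
    rw [hessianForm_regLogisticLoss, hΔ, one_pow, mul_one]
    -- The hypothesis covers only sets of size exactly `k`, so the joint support is enlarged to one;
    -- this uses `k ≤ p`.
    obtain ⟨J, hxJ, -, hJ⟩ := exists_subsuperset_card_eq (subset_univ (supp x ∪ supp Δ)) hcard
      (by simpa using hkp)
    have hΔJ : supp Δ ⊆ J := subset_union_right.trans hxJ
    have h1 := h J hJ (fun j => Δ j) (by
      rw [sum_coe_eq_of_supp_subset hΔJ, real_inner_self_eq_norm_sq, hΔ, one_pow])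
    rw [dotProduct_gram_mulVec] at h1
    simp only [sum_coe_eq_of_supp_subset hΔJ] at h1
    have h2 : ∑ i, Real.exp (inner ℝ (a i) x) / (1 + Real.exp (inner ℝ (a i) x)) ^ 2 *
        inner ℝ (a i) Δ ^ 2 ≤ 1 / 4 * (n * B) := by
      refine le_trans ?_ (mul_le_mul_of_nonneg_left h1 (by norm_num))
      rw [mul_sum]
      exact sum_le_sum fun i _ =>
        mul_le_mul_of_nonneg_right (exp_div_one_add_exp_sq_le _) (sq_nonneg _)
    have h3 : (1 / (n : ℝ)) * (1 / 4 * (n * B)) ≤ B / 4 := by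
      -- For `n = 0` the convention `1 / 0 = 0` makes the left side vanish.
      rcases eq_or_ne (n : ℝ) 0 with h0 | h0
      · rw [h0]; simp; positivity
      · exact le_of_eq (by field_simp)
    have h4 := mul_le_mul_of_nonneg_left h2 (show 0 ≤ 1 / (n : ℝ) by positivity)
    linarith
  have hbb : BddBelow S := ⟨η, hlow⟩
  have hba : BddAbove S := ⟨_, hupp⟩
  have hinf : η ≤ lowerCurvature (regLogisticLoss η a y) k x := le_csInf hne hlow
  have hsup : upperCurvature (regLogisticLoss η a y) k x ≤ η + B / 4 := csSup_le hne hupp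
  have hle : lowerCurvature (regLogisticLoss η a y) k x ≤
      upperCurvature (regLogisticLoss η a y) k x := csInf_le_csSup hne hbb hba
  have hpos := hη.trans_le hinf
  refine ⟨hpos, (one_le_div hpos).2 hle, (div_le_iff₀ hpos).2 (hsup.trans ?_)⟩
  calc η + B / 4 = (1 + B / (4 * η)) * η := by field_simp
    _ ≤ _ := mul_le_mul_of_nonneg_left hinf (by positivity)

end Restricted

/-! ### Restricted second moment matrices and their top eigenvalues. -/

section SecondMoment

variable {p k : ℕ} {ν : Measure (EuclideanSpace ℝ (Fin p))} {J : Finset (Fin p)} {R : ℝ}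

lemma memLp_top_coord_mul_coord (hb : ∀ᵐ v ∂ν, ∑ j ∈ J, v j ^ 2 ≤ R) (j l : J) :
    MemLp (fun v : EuclideanSpace ℝ (Fin p) => v j * v l) ⊤ ν := by
  refine memLp_top_of_bound (by fun_prop) R ?_
  filter_upwards [hb] with v hv
  have h : ∀ j : J, v j ^ 2 ≤ R := fun j =>
    (single_le_sum (f := fun j => v j ^ 2) (fun _ _ => sq_nonneg _) j.2).trans hv
  rw [Real.norm_eq_abs, abs_le]
  constructor <;> nlinarith [h j, h l, sq_nonneg (v j + v l), sq_nonneg (v j - v l)]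

lemma posSemidef_restrict_secondMoment [IsProbabilityMeasure ν]
    (hb : ∀ᵐ v ∂ν, ∑ j ∈ J, v j ^ 2 ≤ R) : (restrict (secondMoment ν) J).PosSemidef := by
  have hI : ∀ j l : J, Integrable (fun v : EuclideanSpace ℝ (Fin p) => v j * v l) ν := fun j l =>
    (memLp_top_coord_mul_coord hb j l).integrable le_top
  refine PosSemidef.of_dotProduct_mulVec_nonneg ?_ fun x => ?_
  · ext j l
    simp [restrict, secondMoment, mul_comm]
  · have e : star x ⬝ᵥ (restrict (secondMoment ν) J *ᵥ x) =
        ∫ v, (∑ j : J, x j * v j) ^ 2 ∂ν := by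
      have e1 : ∀ v : EuclideanSpace ℝ (Fin p), (∑ j : J, x j * v j) ^ 2 =
          ∑ j : J, ∑ l : J, x j * x l * (v j * v l) := fun v => by
        rw [sq, sum_mul_sum]
        exact sum_congr rfl fun j _ => sum_congr rfl fun l _ => by ring
      simp_rw [e1]
      rw [integral_finsetSum _ fun j _ => integrable_finsetSum _ fun l _ => (hI j l).const_mul _]
      simp only [dotProduct, mulVec, star_trivial, mul_sum]
      refine sum_congr rfl fun j _ => ?_
      rw [integral_finsetSum _ fun l _ => (hI j l).const_mul _]
      refine sum_congr rfl fun l _ => ?_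
      rw [integral_const_mul]
      simp only [restrict, secondMoment, submatrix_apply, of_apply]
      ring
    rw [e]
    exact integral_nonneg fun v => sq_nonneg _

/-- If `R ≤ 0`, the coordinates in `J` vanish almost surely, and so do their second moments. -/
lemma pos_of_restrict_secondMoment_ne_zero (hb : ∀ᵐ v ∂ν, ∑ j ∈ J, v j ^ 2 ≤ R)
    (h0 : restrict (secondMoment ν) J ≠ 0) : 0 < R := by
  by_contra! hR
  refine h0 ?_
  ext j l
  simp only [restrict, secondMoment, submatrix_apply, of_apply, Matrix.zero_apply]
  refine integral_eq_zero_of_ae ?_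
  filter_upwards [hb] with v hv
  have h : v j ^ 2 ≤ 0 :=
    (single_le_sum (f := fun j => v j ^ 2) (fun _ _ => sq_nonneg _) j.2).trans (hv.trans hR)
  have : v j = 0 := by
    rw [← sq_eq_zero_iff]
    exact le_antisymm h (sq_nonneg _)
  simp [this]

lemma nonempty_card_eq (hkp : k ≤ p) : Nonempty {J : Finset (Fin p) // J.card = k} := by
  obtain ⟨J, -, hJ⟩ := exists_subset_card_eq (s := (univ : Finset (Fin p))) (n := k)
    (by simpa using hkp)
  exact ⟨⟨J, hJ⟩⟩

lemma thetaTilde_le (ν : Measure (EuclideanSpace ℝ (Fin p))) (hJ : J.card = k) :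
    thetaTilde ν k ≤ thetaMax ν J :=
  ciInf_le (f := fun J : {J : Finset (Fin p) // J.card = k} => thetaMax ν J.1)
    (Set.finite_range _).bddBelow ⟨J, hJ⟩

lemma le_thetaBar (ν : Measure (EuclideanSpace ℝ (Fin p))) (hJ : J.card = k) :
    thetaMax ν J ≤ thetaBar ν k :=
  le_ciSup (f := fun J : {J : Finset (Fin p) // J.card = k} => thetaMax ν J.1)
    (Set.finite_range _).bddAbove ⟨J, hJ⟩

lemma thetaTilde_pos (hkp : k ≤ p) (h : ∀ J : Finset (Fin p), J.card = k → 0 < thetaMax ν J) :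
    0 < thetaTilde ν k := by
  have := nonempty_card_eq hkp
  obtain ⟨J, hJ⟩ := exists_eq_ciInf_of_finite
    (f := fun J : {J : Finset (Fin p) // J.card = k} => thetaMax ν J.1)
  rw [thetaTilde, ← hJ]
  exact h J.1 J.2

end SecondMoment

/-! ### Positivity of the rate and the count of supports. -/

section Counting

lemma h_pos {τ : ℝ} (hτ : 0 < τ) : 0 < h τ := by
  have h1 : (0 : ℝ) < 1 + τ := by linarith
  have h2 := Real.log_lt_sub_one_of_pos (inv_pos.2 h1) (by
    rw [Ne, inv_eq_one]; linarith)
  rw [Real.log_inv] at h2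
  have h3 : (1 + τ) * (1 - (1 + τ)⁻¹) < (1 + τ) * Real.log (1 + τ) :=
    mul_lt_mul_of_pos_left (by linarith) h1
  rw [mul_sub, mul_inv_cancel₀ h1.ne'] at h3
  rw [h]
  linarith

/-- The bound `(e p / k) ^ k`, from `p ^ k / k!` and `k ^ k / k! ≤ exp k`. -/
lemma choose_le_exp {p k : ℕ} (hk : 1 ≤ k) (hkp : k ≤ p) :
    (p.choose k : ℝ) ≤ Real.exp (k * (1 + Real.log ((p : ℝ) / k))) := by
  have hk0 : (0 : ℝ) < k := by exact_mod_cast hk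
  have hp0 : (0 : ℝ) < p := by exact_mod_cast hk.trans hkp
  have h1 : (k : ℝ) ^ k / k.factorial ≤ Real.exp k :=
    Real.pow_div_factorial_le_exp _ hk0.le k
  have h2 : Real.exp (k * (1 + Real.log ((p : ℝ) / k))) = Real.exp k * ((p : ℝ) / k) ^ k := by
    rw [mul_add, mul_one, Real.exp_add, Real.exp_nat_mul, Real.exp_log (by positivity)]
  rw [h2]
  calc (p.choose k : ℝ) ≤ (p : ℝ) ^ k / k.factorial := Nat.choose_le_pow_div k p
    _ = (k : ℝ) ^ k / k.factorial * ((p : ℝ) / k) ^ k := by rw [div_pow]; field_simp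
    _ ≤ _ := mul_le_mul_of_nonneg_right h1 (by positivity)

end Counting

/-! ### Tail bound for one support, and the sample size. -/

section Tail

variable {Ω : Type*} [MeasurableSpace Ω] {P : Measure Ω} [IsProbabilityMeasure P] {p k n : ℕ}
  {ν : Measure (EuclideanSpace ℝ (Fin p))} [IsProbabilityMeasure ν]
  {a : Fin n → Ω → EuclideanSpace ℝ (Fin p)} {J : Finset (Fin p)} {R τ : ℝ}

lemma measureReal_lt_dotProduct_gram_coord_le (hlaw : ∀ i, HasLaw (a i) ν P)
    (hindep : iIndepFun a P) (hb : ∀ᵐ v ∂ν, ∑ j ∈ J, v j ^ 2 ≤ R)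
    (h0 : restrict (secondMoment ν) J ≠ 0) (hτ : 0 ≤ τ) :
    P.real {ω | ∃ x : J → ℝ, x ⬝ᵥ x = 1 ∧ (1 + τ) * (n * thetaMax ν J) <
        x ⬝ᵥ (gram (fun i (j : J) => a i ω j) univ *ᵥ x)} ≤
      J.card * Real.exp (-(n * thetaMax ν J * h τ / R)) := by
  have hm : Measurable fun (v : EuclideanSpace ℝ (Fin p)) (j : J) => v j := by fun_prop
  have hC := posSemidef_restrict_secondMoment hb
  have key := measureReal_lt_dotProduct_gram_le (P := P) (w := fun i ω (j : J) => a i ω j)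
    (fun i => hm.comp_aemeasurable (hlaw i).aemeasurable) (R := R) (fun i => ?_)
    (pos_of_restrict_secondMoment_ne_zero hb h0) (hindep.comp (fun _ v (j : J) => v j) fun _ => hm)
    (C := restrict (secondMoment ν) J) (fun i j l => ?_) hC.1 (lambdaMax_pos hC h0).le hτ univ
  · simpa [thetaMax] using key
  · have := (hlaw i).map_eq ▸ hb
    filter_upwards [ae_of_ae_map (hlaw i).aemeasurable this] with ω hω
    rw [dotProduct, sum_coe_sort J fun j => a i ω j * a i ω j]
    simpa only [sq] using hω
  · exact (hlaw i).integral_comp (f := fun v : EuclideanSpace ℝ (Fin p) => v j * v l)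
      (memLp_top_coord_mul_coord hb j l).1

/-- In the sample size, `log k` pays for the dimension factor, `k (1 + log (p / k))` for the number
of supports, and `-log ε` for the confidence. Using `thetaTilde` makes the bound uniform in `J`. -/
lemma card_mul_exp_neg_le {ε : ℝ} (hk : 1 ≤ k) (hkp : k ≤ p) (hε : 0 < ε) (hτ : 0 < τ)
    (hR : 0 < R) (hθ : 0 < thetaTilde ν k) (hJ : J.card = k)
    (hn : R * (Real.log k + k * (1 + Real.log ((p : ℝ) / k)) - Real.log ε) /
      (thetaTilde ν k * h τ) ≤ n) :
    J.card * Real.exp (-(n * thetaMax ν J * h τ / R)) ≤ ε / p.choose k := by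
  have hk0 : (0 : ℝ) < k := by exact_mod_cast hk
  have hc0 : (0 : ℝ) < p.choose k := by exact_mod_cast Nat.choose_pos hkp
  have hh := h_pos hτ
  rw [div_le_iff₀ (by positivity)] at hn
  have h1 : (n : ℝ) * (thetaTilde ν k * h τ) ≤ n * thetaMax ν J * h τ := by
    rw [mul_assoc]
    have := thetaTilde_le ν hJ
    gcongr
  have h2 : Real.log k + k * (1 + Real.log ((p : ℝ) / k)) - Real.log ε ≤
      n * thetaMax ν J * h τ / R := by
    rw [le_div_iff₀ hR]
    linarith
  calc (J.card : ℝ) * Real.exp (-(n * thetaMax ν J * h τ / R))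
      ≤ k * Real.exp (Real.log ε - Real.log k - k * (1 + Real.log ((p : ℝ) / k))) := by
        rw [hJ]
        gcongr
        linarith
    _ = ε / Real.exp (k * (1 + Real.log ((p : ℝ) / k))) := by
        rw [Real.exp_sub, Real.exp_sub, Real.exp_log hε, Real.exp_log hk0]
        field_simp
    _ ≤ ε / p.choose k := by
        gcongr
        exact choose_le_exp hk hkp

end Tail

end SparseLogistic

theorem mainTheorem3 {Ω : Type*} [MeasurableSpace Ω] (P : Measure Ω) [IsProbabilityMeasure P]
    (p k n : ℕ) (hk : 1 ≤ k) (hkp : k ≤ p)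
    (ν : Measure (EuclideanSpace ℝ (Fin p))) [IsProbabilityMeasure ν]
    (a : Fin n → Ω → EuclideanSpace ℝ (Fin p)) (y : Fin n → Ω → ℝ)
    (hlaw : ∀ i, HasLaw (a i) ν P) (hindep : iIndepFun a P)
    (hy : ∀ i ω, y i ω = 0 ∨ y i ω = 1)
    (R : ℝ)
    (hbound : ∀ J : Finset (Fin p), J.card = k → ∀ᵐ v ∂ν, ∑ j ∈ J, v j ^ 2 ≤ R)
    (hnondeg : ∀ J : Finset (Fin p), J.card = k →
      SparseLogistic.restrict (SparseLogistic.secondMoment ν) J ≠ 0)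
    (η τ ε : ℝ) (hη : 0 < η) (hτ : 0 < τ) (hε₀ : 0 < ε) (hε₁ : ε < 1)
    (hn : R * (Real.log k + k * (1 + Real.log ((p : ℝ) / k)) - Real.log ε) /
      (SparseLogistic.thetaTilde ν k * SparseLogistic.h τ) ≤ n) :
    ∃ E : Set Ω, MeasurableSet E ∧ ENNReal.ofReal (1 - ε) ≤ P E ∧
      ∀ ω ∈ E, ∃ m : ℝ, m ≤ 1 + (1 + τ) / (4 * η) * SparseLogistic.thetaBar ν k ∧
        SparseLogistic.HasSRH
          (SparseLogistic.regLogisticLoss η (fun i => a i ω) (fun i => y i ω)) k m := by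
  open SparseLogistic Matrix in
  have hθpos : ∀ J : Finset (Fin p), J.card = k → 0 < thetaMax ν J := fun J hJ =>
    lambdaMax_pos (posSemidef_restrict_secondMoment (hbound J hJ)) (hnondeg J hJ)
  obtain ⟨J₀, hJ₀⟩ := nonempty_card_eq hkp
  have hR : 0 < R := pos_of_restrict_secondMoment_ne_zero (hbound J₀ hJ₀) (hnondeg J₀ hJ₀)
  have hθt := thetaTilde_pos hkp hθpos
  have hθb : 0 ≤ thetaBar ν k := (hθpos J₀ hJ₀).le.trans (le_thetaBar ν hJ₀)
  set bad : Finset (Fin p) → Set Ω := fun J =>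
    {ω | ∃ x : J → ℝ, x ⬝ᵥ x = 1 ∧ (1 + τ) * (n * thetaMax ν J) <
      x ⬝ᵥ (gram (fun i (j : J) => a i ω j) Finset.univ *ᵥ x)} with hbad
  set B : Set Ω := ⋃ J ∈ Finset.powersetCard k (Finset.univ : Finset (Fin p)), bad J with hB
  have hPB : P.real B ≤ ε := by
    refine (measureReal_biUnion_finset_le _ _).trans ?_
    have hle : ∀ J ∈ Finset.powersetCard k (Finset.univ : Finset (Fin p)),
        P.real (bad J) ≤ ε / p.choose k := fun J hJ => by
      have hJk := (Finset.mem_powersetCard.1 hJ).2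
      exact (measureReal_lt_dotProduct_gram_coord_le hlaw hindep (hbound J hJk) (hnondeg J hJk)
        hτ.le).trans (card_mul_exp_neg_le hk hkp hε₀ hτ hR hθt hJk hn)
    refine (Finset.sum_le_card_nsmul _ _ _ hle).trans (le_of_eq ?_)
    have hc0 : (p.choose k : ℝ) ≠ 0 := by exact_mod_cast (Nat.choose_pos hkp).ne'
    rw [Finset.card_powersetCard, Finset.card_univ, Fintype.card_fin, nsmul_eq_mul]
    field_simp
  -- A measurable hull of the same measure replaces `B`, so measurability of `B` itself is never
  -- needed.
  refine ⟨(toMeasurable P B)ᶜ, (measurableSet_toMeasurable P B).compl, ?_, fun ω hω => ?_⟩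
  · rw [prob_compl_eq_one_sub (measurableSet_toMeasurable P B), measure_toMeasurable,
      ENNReal.ofReal_sub _ hε₀.le, ENNReal.ofReal_one]
    refine tsub_le_tsub_left ?_ 1
    rw [← ofReal_measureReal (measure_ne_top P B)]
    exact ENNReal.ofReal_le_ofReal hPB
  · have hωB : ω ∉ B := fun hmem => hω (subset_toMeasurable P B hmem)
    refine ⟨1 + ((1 + τ) * thetaBar ν k) / (4 * η), le_of_eq (by ring),
      hasSRH_of_forall_gram_le hk hkp hη (by positivity) _ _ fun J hJ x hx => ?_⟩
    -- Exceeding the level set by `thetaBar` means exceeding the lower level set by `thetaMax ν J`,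
    -- which puts `ω` in the bad event of `J`.
    by_contra! hlt
    refine hωB (Set.mem_biUnion (Finset.mem_powersetCard.2 ⟨Finset.subset_univ J, hJ⟩)
      ⟨x, hx, lt_of_le_of_lt ?_ hlt⟩)
    rw [mul_left_comm]
    have := le_thetaBar ν hJ
    gcongr
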